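/- Let $d\ge 2$, let $q_1,\dots,q_d$ be positive integers with $\gcd(q_1,\dots,q_d)=1$, and let $V:\mathbb{Z}^d\to\mathbb{C}$ be any function that is periodic with respect to $\Gamma=q_1\mathbb{Z}\oplus\cdots\oplus q_d\mathbb{Z}$. Put $Q=q_1\cdots q_d$, $W=\{n\in\mathbb{Z}^d: 0\le n_j\le q_j-1,\ 1\le j\le d\}$, and let $(\Delta u)(n)=\sum_{\|n'-n\|_1=1}u(n')$ be the discrete Laplacian. For $z=(z_1,\dots,z_d)$ with all $z_j\neq 0$, let $\mathcal{D}(z)$ be the $Q\times Q$ matrix of $-\Delta+V$ acting on the functions $u$ on $\mathbb{Z}^d$ that satisfy $u(n+q_j\mathbf{e}_j)=z_ju(n)$ for all $n\in\mathbb{Z}^d$ and $1\le j\le d$, in the coordinates $\{u(n)\}_{n\in W}$. Let $\mathcal{P}(z,\lambda)=\det(\mathcal{D}(z)-\lambda I)$; it is a Laurent polynomial in $z_1,\dots,z_d,\lambda$ (and a polynomial in $\lambda$). A Laurent polynomial is called a monomial if it consists of a single term with non-zero complex coefficient, and a Laurent polynomial $h$ is called irreducible if there are no non-monomial Laurent polynomials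 $f,g$ in the same variables with $h=fg$. Theorem. The Laurent polynomial $\mathcal{P}(z,\lambda)$, as a function of both $z$ and $\lambda$, i.e. in the $d+1$ variables $z_1,\dots,z_d,\lambda$, is irreducible. -/

import Mathlib

/-- Laurent polynomials with complex coefficients in variables indexed by `σ` (finite in all uses):
finite sums of terms `c * ∏ i, X i ^ a i` with `a : σ → ℤ`. -/
abbrev MvLaurent (σ : Type*) : Type _ := AddMonoidAlgebra ℂ (σ → ℤ)

namespace MvLaurent

/-- A monomial: a Laurent polynomial with a single term and nonzero coefficient. -/
def IsMonomial {σ : Type*} (f : MvLaurent σ) : Prop :=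
  ∃ (a : σ → ℤ) (c : ℂ), c ≠ 0 ∧ f = AddMonoidAlgebra.single a c

/-- A Laurent polynomial is irreducible if it is not a product of two non-monomial
Laurent polynomials. -/
def IsIrreducible {σ : Type*} (h : MvLaurent σ) : Prop :=
  ¬ ∃ f g : MvLaurent σ, ¬ f.IsMonomial ∧ ¬ g.IsMonomial ∧ h = f * g

end MvLaurent

namespace Floquet

/-- The ring of Laurent polynomials in the `d + 1` variables `z₁, …, z_d, lam`; the last index
belongs to the spectral parameter `lam`. -/
abbrev Ring (d : ℕ) : Type := MvLaurent (Fin (d + 1))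

/-- The constant Laurent polynomial `c`. -/
noncomputable def const {d : ℕ} (c : ℂ) : Ring d := AddMonoidAlgebra.single 0 c

/-- The Laurent monomial `z ^ a = z₁ ^ a₁ ⋯ z_d ^ a_d`. -/
noncomputable def zPow {d : ℕ} (a : Fin d → ℤ) : Ring d :=
  AddMonoidAlgebra.single (Fin.snoc (α := fun _ => ℤ) a 0) 1

/-- The spectral variable. -/
noncomputable def lam {d : ℕ} : Ring d :=
  AddMonoidAlgebra.single (Pi.single (Fin.last d) 1) 1

/-- `V` is periodic with respect to the lattice `q₁ℤ ⊕ ⋯ ⊕ q_dℤ`. -/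
def IsPeriodic {d : ℕ} (q : Fin d → ℕ) (V : (Fin d → ℤ) → ℂ) : Prop :=
  ∀ n k : Fin d → ℤ, V (fun j => n j + q j * k j) = V n

/-- The discrete Laplacian: the sum over the `2 d` sites at `ℓ¹`-distance one. It acts on functions
with values in any abelian group. -/
def laplacian {d : ℕ} {R : Type*} [AddCommGroup R] (u : (Fin d → ℤ) → R) (n : Fin d → ℤ) : R :=
  ∑ j, (u (n + Pi.single j 1) + u (n - Pi.single j 1))

/-- The Schrödinger operator `-Δ + V` on functions whose values are Laurent polynomials. -/
noncomputable def schrodinger {d : ℕ} (V : (Fin d → ℤ) → ℂ) (u : (Fin d → ℤ) → Ring d)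
    (n : Fin d → ℤ) : Ring d :=
  -laplacian u n + const (V n) * u n

/-- The fundamental domain `{n : 0 ≤ n j ≤ q j - 1}`, with `∏ j, q j` elements. -/
abbrev Cell {d : ℕ} (q : Fin d → ℕ) : Type := (j : Fin d) → Fin (q j)

/-- A point of the fundamental domain as a lattice point. -/
def Cell.toLattice {d : ℕ} {q : Fin d → ℕ} (n : Cell q) : Fin d → ℤ := fun j => ((n j : ℕ) : ℤ)

/-- The representative in the fundamental domain of a lattice point. -/
def residue {d : ℕ} (q : Fin d → ℕ) [∀ j, NeZero (q j)] (m : Fin d → ℤ) : Cell q := fun j =>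
  ⟨(m j % (q j : ℤ)).toNat, by
    have h : (0 : ℤ) < q j := by exact_mod_cast Nat.pos_of_ne_zero (NeZero.ne (q j))
    have h1 := Int.emod_nonneg (m j) h.ne'
    have h2 := Int.emod_lt_of_pos (m j) h
    omega⟩

/-- The extension of a function `v` on the fundamental domain to the function `u` on `ℤ^d` with
`u = v` on the fundamental domain and `u (n + q j • e j) = z j * u n` for all `j` and `n`. -/
noncomputable def extend {d : ℕ} (q : Fin d → ℕ) [∀ j, NeZero (q j)] (v : Cell q → Ring d)
    (m : Fin d → ℤ) : Ring d :=
  zPow (fun j => m j / (q j : ℤ)) * v (residue q m)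

theorem extend_toLattice {d : ℕ} (q : Fin d → ℕ) [∀ j, NeZero (q j)] (v : Cell q → Ring d)
    (n : Cell q) : extend q v n.toLattice = v n := by
  have h0 : (fun j => n.toLattice j / (q j : ℤ)) = 0 := by
    funext j
    exact Int.ediv_eq_zero_of_lt (by simp [Cell.toLattice]) (by simp [Cell.toLattice])
  have h1 : residue q n.toLattice = n := by
    funext j
    apply Fin.ext
    have : (n.toLattice j) % (q j : ℤ) = ((n j : ℕ) : ℤ) :=
      Int.emod_eq_of_lt (by simp [Cell.toLattice]) (by simp [Cell.toLattice])
    simp [residue, this]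
  have h2 : (Fin.snoc (α := fun _ => ℤ) (0 : Fin d → ℤ) 0 : Fin (d + 1) → ℤ) = 0 := by
    funext i
    refine Fin.lastCases ?_ (fun i => ?_) i <;> simp
  rw [extend, h0, h1, zPow, h2, ← AddMonoidAlgebra.one_def, one_mul]

theorem extend_add_period {d : ℕ} (q : Fin d → ℕ) [∀ j, NeZero (q j)] (v : Cell q → Ring d)
    (m : Fin d → ℤ) (j : Fin d) :
    extend q v (m + Pi.single j (q j : ℤ)) = zPow (Pi.single j 1) * extend q v m := by
  have hr : residue q (m + Pi.single j (q j : ℤ)) = residue q m := by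
    funext i
    apply Fin.ext
    by_cases h : i = j
    · subst h; simp [residue]
    · simp [residue, h]
  have hd : (fun i => (m + Pi.single j (q j : ℤ) : Fin d → ℤ) i / (q i : ℤ))
      = Pi.single j 1 + fun i => m i / (q i : ℤ) := by
    funext i
    by_cases h : i = j
    · subst h
      have h0 : (q i : ℤ) ≠ 0 := by exact_mod_cast NeZero.ne (q i)
      simp [Int.add_ediv_of_dvd_right, Int.ediv_self h0, add_comm]
    · simp [h]
  rw [extend, extend, hr, hd, ← mul_assoc, zPow, zPow, zPow, AddMonoidAlgebra.single_mul_single,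
    one_mul]
  congr 2
  funext i
  refine Fin.lastCases ?_ (fun i => ?_) i <;> simp

/-- The matrix of `-Δ + V` acting on the functions on `ℤ^d` with
`u (n + q j • e j) = z j * u n`, in the coordinates given by the values on the fundamental domain:
column `n'` holds the values of `(-Δ + V) u` for the `u` that is the indicator of `n'` there. -/
noncomputable def floquetMatrix {d : ℕ} (q : Fin d → ℕ) [∀ j, NeZero (q j)]
    (V : (Fin d → ℤ) → ℂ) : Matrix (Cell q) (Cell q) (Ring d) :=
  Matrix.of fun n n' => schrodinger V (extend q (Pi.single n' 1)) n.toLattice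

/-- The Laurent polynomial `det (D(z) - lam I)` in `z₁, …, z_d, lam`. -/
noncomputable def dispersion {d : ℕ} (q : Fin d → ℕ) [∀ j, NeZero (q j)]
    (V : (Fin d → ℤ) → ℂ) : Ring d :=
  (floquetMatrix q V - Matrix.scalar (Cell q) lam).det

end Floquet

/-! Up to sign, `dispersion` is the characteristic polynomial in `lam` of a matrix over the Laurent
polynomials in `z`. Substitute `z j = (ζ j / s) ^ q j`. A gauge transformation turns the matrix into
`-∑ j, ((ζ j / s) * S j + (s / ζ j) * (S j)⁻¹) + v` with cyclic shifts `S j`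
(`charpoly_blochMatrix`). Multiplied by `s`, it is polynomial in `s`, and at `s = 0` both `v` and
the backward shifts vanish. What remains, `-∑ j, ζ j * S j`, has the `Q` distinct eigenvalues `-∑ j,
ρ j * ζ j` with `ρ j ^ q j = 1`.

The substitutions `ζ j ↦ ρ j * ζ j` permute these eigenvalues transitively and fix every Laurent
polynomial in `z`. Hence they fix the coefficients of any monic factor over that ring. Since `K[s]`,
`K = ℂ(ζ)`, is integrally closed, the rescaled factors have coefficients in `K[s]` and can be
specialized at `s = 0` without losing degree. A factor with one of the roots then has all `Q` of
them, so the other factor is constant (`laurentMatrix_charpoly_factor`).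

A general factorization reduces to this one: powers of `lam` are units, leading coefficients divide
`±1`, and units of a Laurent polynomial ring are monomials (`MvLaurent.IsMonomial.of_mul_eq_one`).
-/

open Polynomial

namespace Floquet

/-! ### Laurent monomials on the lattice -/

section Lattice

variable {d : ℕ} {q : Fin d → ℕ} [∀ j, NeZero (q j)] {K : Type*} [Field K]

/-- The Laurent monomial `y ^ m = ∏ j, y j ^ m j`. -/
def latticePow (y : Fin d → K) (m : Fin d → ℤ) : K := ∏ j, y j ^ m j

theorem latticePow_ne_zero {y : Fin d → K} (hy : ∀ j, y j ≠ 0) (m : Fin d → ℤ) :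
    latticePow y m ≠ 0 :=
  Finset.prod_ne_zero_iff.2 fun j _ => zpow_ne_zero _ (hy j)

theorem latticePow_add {y : Fin d → K} (hy : ∀ j, y j ≠ 0) (m n : Fin d → ℤ) :
    latticePow y (m + n) = latticePow y m * latticePow y n := by
  simp [latticePow, ← Finset.prod_mul_distrib, zpow_add₀ (hy _)]

theorem latticePow_neg (y : Fin d → K) (m : Fin d → ℤ) :
    latticePow y (-m) = (latticePow y m)⁻¹ := by
  simp [latticePow]

theorem latticePow_single (y : Fin d → K) (j : Fin d) : latticePow y (Pi.single j 1) = y j := by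
  rw [latticePow, Finset.prod_eq_single j]
  · simp
  · intro i _ h
    simp [h]
  · simp

theorem latticePow_div_mul_residue {y : Fin d → K} (hy : ∀ j, y j ≠ 0) (m : Fin d → ℤ) :
    latticePow y (fun j => q j * (m j / q j)) * latticePow y (residue q m).toLattice =
      latticePow y m := by
  rw [← latticePow_add hy]
  congr 1
  funext j
  have h : (0 : ℤ) < q j := by exact_mod_cast Nat.pos_of_ne_zero (NeZero.ne (q j))
  have h1 := Int.emod_nonneg (m j) h.ne'
  simp [Cell.toLattice, residue, max_eq_left h1, Int.mul_ediv_add_emod]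

theorem latticePow_residue_of_pow_eq_one {y : Fin d → K} (hy : ∀ j, y j ^ q j = 1)
    (m : Fin d → ℤ) : latticePow y (residue q m).toLattice = latticePow y m := by
  have hy0 : ∀ j, y j ≠ 0 := fun j h => by
    have := hy j
    rw [h, zero_pow (NeZero.ne _)] at this
    exact zero_ne_one this
  rw [← latticePow_div_mul_residue (q := q) hy0 m]
  have : latticePow y (fun j => q j * (m j / q j)) = 1 := by
    simp [latticePow, zpow_mul, hy]
  rw [this, one_mul]

end Lattice

/-! ### Bloch matrices and cyclic shift matrices -/

section Matrices

variable {d : ℕ} {R S : Type*} [CommRing R] [CommRing S]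

/-- The matrix of `-Δ + v` on functions that pick up the factor `χ k` under translation by the
period `q * k`, in the coordinates given by the values on the fundamental domain. -/
def blochMatrix (q : Fin d → ℕ) [∀ j, NeZero (q j)] (χ : (Fin d → ℤ) → R) (v : Cell q → R) :
    Matrix (Cell q) (Cell q) R :=
  Matrix.of fun n n' =>
    -∑ j, (χ (fun i => (n.toLattice + Pi.single j 1 : Fin d → ℤ) i / (q i : ℤ)) *
          (if residue q (n.toLattice + Pi.single j 1) = n' then 1 else 0) +
        χ (fun i => (n.toLattice - Pi.single j 1 : Fin d → ℤ) i / (q i : ℤ)) *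
          (if residue q (n.toLattice - Pi.single j 1) = n' then 1 else 0)) +
      v n * (if n = n' then 1 else 0)

/-- The matrix `-∑ j, (y j * S j + y' j * (S j)⁻¹) + v`, where `S j` is the cyclic shift in the
`j`-th coordinate of the fundamental domain. -/
def shiftMatrix (q : Fin d → ℕ) [∀ j, NeZero (q j)] (y y' : Fin d → R) (v : Cell q → R) :
    Matrix (Cell q) (Cell q) R :=
  Matrix.of fun n n' =>
    -∑ j, (y j * (if residue q (n.toLattice + Pi.single j 1) = n' then 1 else 0) +
        y' j * (if residue q (n.toLattice - Pi.single j 1) = n' then 1 else 0)) +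
      v n * (if n = n' then 1 else 0)

variable (q : Fin d → ℕ) [∀ j, NeZero (q j)]

/-- With the multipliers as an arbitrary function `χ`, the matrix can be transported along ring
homomorphisms. -/
theorem floquetMatrix_eq_blochMatrix (V : (Fin d → ℤ) → ℂ) :
    floquetMatrix q V = blochMatrix q zPow fun n => const (V n.toLattice) := by
  ext1 n n'
  simp only [floquetMatrix, blochMatrix, Matrix.of_apply, schrodinger, laplacian, extend_toLattice]
  simp only [extend, Pi.single_apply]

theorem blochMatrix_map (χ : (Fin d → ℤ) → R) (v : Cell q → R) (f : R →+* S) :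
    (blochMatrix q χ v).map f = blochMatrix q (fun a => f (χ a)) fun n => f (v n) := by
  ext1 n n'
  simp only [blochMatrix, Matrix.map_apply, Matrix.of_apply]
  simp [map_sum, apply_ite f]

theorem shiftMatrix_map (y y' : Fin d → R) (v : Cell q → R) (f : R →+* S) :
    (shiftMatrix q y y' v).map f =
      shiftMatrix q (fun j => f (y j)) (fun j => f (y' j)) fun n => f (v n) := by
  ext1 n n'
  simp only [shiftMatrix, Matrix.map_apply, Matrix.of_apply]
  simp [map_sum, apply_ite f]

theorem smul_shiftMatrix (c : R) (y y' : Fin d → R) (v : Cell q → R) :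
    c • shiftMatrix q y y' v =
      shiftMatrix q (fun j => c * y j) (fun j => c * y' j) fun n => c * v n := by
  ext1 n n'
  simp only [shiftMatrix, Matrix.smul_apply, Matrix.of_apply, smul_eq_mul]
  rw [mul_add, mul_neg, Finset.mul_sum, mul_assoc]
  simp only [mul_add, mul_assoc]

/-- Gauge transformation: writing `u n = y ^ n * w n` with `z j = y j ^ q j` makes `w` periodic and
moves the multipliers from the boundary of the cell onto every bond. -/
theorem blochMatrix_mul_diagonal {K : Type*} [Field K] {y : Fin d → K} (hy : ∀ j, y j ≠ 0)
    (v : Cell q → K) :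
    blochMatrix q (fun a => latticePow y fun j => q j * a j) v *
        Matrix.diagonal (fun n => latticePow y n.toLattice) =
      Matrix.diagonal (fun n => latticePow y n.toLattice) *
        shiftMatrix q y (fun j => (y j)⁻¹) v := by
  ext1 n n'
  rw [Matrix.mul_diagonal, Matrix.diagonal_mul]
  simp only [blochMatrix, shiftMatrix, Matrix.of_apply]
  rw [add_mul, mul_add, neg_mul, mul_neg, Finset.sum_mul, Finset.mul_sum]
  congr 1
  · congr 1
    refine Finset.sum_congr rfl fun j _ => ?_
    rw [add_mul, mul_add]
    congr 1
    · split_ifs with h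
      · rw [← h, mul_one, latticePow_div_mul_residue hy, latticePow_add hy, latticePow_single,
          mul_one]
      · simp
    · split_ifs with h
      · rw [← h, mul_one, latticePow_div_mul_residue hy, sub_eq_add_neg, latticePow_add hy,
          latticePow_neg, latticePow_single, mul_one]
      · simp
  · split_ifs with h
    · rw [h]; ring
    · simp

theorem charpoly_blochMatrix {K : Type*} [Field K] {y : Fin d → K} (hy : ∀ j, y j ≠ 0)
    (v : Cell q → K) :
    (blochMatrix q (fun a => latticePow y fun j => q j * a j) v).charpoly =
      (shiftMatrix q y (fun j => (y j)⁻¹) v).charpoly := by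
  have hu : IsUnit (Matrix.diagonal fun n : Cell q => latticePow y n.toLattice) := by
    rw [Matrix.isUnit_iff_isUnit_det, Matrix.det_diagonal, isUnit_iff_ne_zero]
    exact Finset.prod_ne_zero_iff.2 fun n _ => latticePow_ne_zero hy _
  obtain ⟨u, hu⟩ := hu
  have h := blochMatrix_mul_diagonal q hy v
  rw [← hu] at h
  rw [← Matrix.charpoly_units_conj' u (blochMatrix q _ v), ← Matrix.coe_units_inv, mul_assoc, h,
    Units.inv_mul_cancel_left]

/-- The character `n ↦ ρ ^ n` is well defined modulo the periods and is a common eigenvector of all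
cyclic shifts. -/
theorem eval_charpoly_shiftMatrix {K : Type*} [Field K] (y : Fin d → K) {ρ : Fin d → K}
    (hρ : ∀ j, ρ j ^ q j = 1) :
    (shiftMatrix q y 0 0).charpoly.eval (-∑ j, ρ j * y j) = 0 := by
  have hρ0 : ∀ j, ρ j ≠ 0 := fun j h => by
    have := hρ j
    rw [h, zero_pow (NeZero.ne _)] at this
    exact zero_ne_one this
  rw [Matrix.eval_charpoly, ← Matrix.exists_mulVec_eq_zero_iff]
  refine ⟨fun n => latticePow ρ n.toLattice,
    fun h => latticePow_ne_zero hρ0 _ (congrFun h (residue q 0)), ?_⟩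
  rw [Matrix.sub_mulVec, sub_eq_zero]
  funext n
  have h1 : (shiftMatrix q y 0 0).mulVec (fun n => latticePow ρ n.toLattice) n =
      -∑ j, y j * latticePow ρ (residue q (n.toLattice + Pi.single j 1)).toLattice := by
    simp only [Matrix.mulVec, dotProduct, shiftMatrix, Matrix.of_apply, Pi.zero_apply, zero_mul,
      add_zero, neg_mul, Finset.sum_mul, Finset.sum_neg_distrib]
    rw [Finset.sum_comm]
    simp
  rw [h1]
  simp only [latticePow_residue_of_pow_eq_one hρ, latticePow_add hρ0, latticePow_single]
  rw [Matrix.scalar_apply, Matrix.mulVec_diagonal, neg_mul, Finset.sum_mul]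
  congr 1
  exact Finset.sum_congr rfl fun j _ => by ring

end Matrices

/-- As `s ≠ 0`, every point is some `s * y`, and there `det (s * y - s • M) = s ^ n * det (y - M)`,
with `n` the size of the matrix. -/
theorem _root_.Matrix.charpoly_smul_eq_scaleRoots {n K : Type*} [Fintype n] [DecidableEq n]
    [Field K] [Infinite K] (M : Matrix n n K) {s : K} (hs : s ≠ 0) :
    (s • M).charpoly = M.charpoly.scaleRoots s := by
  refine Polynomial.funext fun x => ?_
  obtain ⟨x, rfl⟩ : ∃ y, x = s * y := ⟨s⁻¹ * x, by field_simp⟩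
  rw [scaleRoots_eval_mul, Matrix.eval_charpoly, Matrix.eval_charpoly,
    Matrix.charpoly_natDegree_eq_dim, ← Matrix.det_smul, smul_sub]
  congr 2
  rw [Matrix.scalar_apply, Matrix.scalar_apply, ← Matrix.diagonal_smul]
  rfl

end Floquet

namespace Floquet

/-! ### Descent of monic factors, and roots permuted by field endomorphisms -/

/-- Monic factors, over the fraction field, of a monic polynomial over an integrally closed domain
have coefficients in the domain. -/
theorem _root_.Polynomial.Monic.exists_map_eq_of_mul_eq_map {R L : Type*} [CommRing R] [IsDomain R]
    [IsIntegrallyClosed R] [Field L] [Algebra R L] [IsFractionRing R L] {p : R[X]} (hp : p.Monic)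
    {f g : L[X]} (hf : f.Monic) (hfg : f * g = p.map (algebraMap R L)) :
    ∃ F : R[X], F.map (algebraMap R L) = f := by
  obtain ⟨F, hF⟩ := IsIntegrallyClosed.eq_map_mul_C_of_dvd L hp (Dvd.intro _ hfg)
  exact ⟨F, by simpa [hf.leadingCoeff] using hF⟩

/-- If `f` and `g` are invariant under field endomorphisms that map a root `r₀` of `f * g` to each
member of a family `r` of distinct elements, then one of the factors vanishes on the whole family. -/
theorem card_le_natDegree_of_transitive {K ι : Type*} [Field K] [Fintype ι] [Nonempty ι] (r : ι → K)
    (hr : Function.Injective r) (σ : ι → K →+* K) (r₀ : K) (hσ : ∀ n, σ n r₀ = r n)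
    {f g : K[X]} (hf0 : f ≠ 0) (hg0 : g ≠ 0) (hf : ∀ n, f.map (σ n) = f)
    (hg : ∀ n, g.map (σ n) = g) (hfg : (f * g).eval r₀ = 0) :
    Fintype.card ι ≤ f.natDegree ∨ Fintype.card ι ≤ g.natDegree := by
  classical
  have key : ∀ p : K[X], p ≠ 0 → (∀ n, p.map (σ n) = p) → p.eval r₀ = 0 →
      Fintype.card ι ≤ p.natDegree := by
    intro p hp0 hp h
    have h1 : ∀ n, p.eval (r n) = 0 := fun n => by
      rw [← hσ n, ← hp n, eval_map_apply, h, map_zero]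
    refine le_trans ?_ (p.card_roots')
    rw [← Finset.card_univ, ← Finset.card_image_of_injective _ hr]
    refine le_trans (Finset.card_le_card ?_) (Multiset.toFinset_card_le _)
    intro x hx
    obtain ⟨n, -, rfl⟩ := Finset.mem_image.1 hx
    rw [Multiset.mem_toFinset, mem_roots hp0]
    exact h1 n
  rw [eval_mul, mul_eq_zero] at hfg
  exact hfg.imp (key f hf0 hf) (key g hg0 hg)

/-! ### The function field of the covering torus and the scaling parameter -/

section Torus

variable {d : ℕ}

/-- The field of rational functions in `d` variables. -/
abbrev TorusField (d : ℕ) : Type := FractionRing (MvPolynomial (Fin d) ℂ)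

/-- The coordinate functions. -/
noncomputable def torusVar (j : Fin d) : TorusField d :=
  algebraMap (MvPolynomial (Fin d) ℂ) _ (MvPolynomial.X j)

/-- The constant functions. -/
noncomputable def torusConst (d : ℕ) : ℂ →+* TorusField d :=
  (algebraMap (MvPolynomial (Fin d) ℂ) (TorusField d)).comp MvPolynomial.C

theorem torusVar_ne_zero (j : Fin d) : torusVar j ≠ 0 := by
  rw [torusVar, Ne, FaithfulSMul.algebraMap_eq_zero_iff]
  exact MvPolynomial.X_ne_zero j

/-- The endomorphism multiplying the `j`-th variable by `u j`. -/
noncomputable def scaleVars (u : Fin d → ℂ) : MvPolynomial (Fin d) ℂ →ₐ[ℂ] MvPolynomial (Fin d) ℂ :=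
  MvPolynomial.aeval fun j => MvPolynomial.C (u j) * MvPolynomial.X j

theorem scaleVars_injective {u : Fin d → ℂ} (hu : ∀ j, u j ≠ 0) :
    Function.Injective (scaleVars u : MvPolynomial (Fin d) ℂ →+* MvPolynomial (Fin d) ℂ) := by
  refine Function.LeftInverse.injective (g := scaleVars fun j => (u j)⁻¹) fun p => ?_
  have : (scaleVars fun j => (u j)⁻¹).comp (scaleVars u) = AlgHom.id ℂ _ := by
    refine MvPolynomial.algHom_ext fun j => ?_
    rw [AlgHom.comp_apply, scaleVars, scaleVars, MvPolynomial.aeval_X, map_mul,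
      MvPolynomial.aeval_X, MvPolynomial.algHom_C, MvPolynomial.algebraMap_eq, ← mul_assoc,
      ← map_mul, mul_inv_cancel₀ (hu j), map_one, one_mul, AlgHom.id_apply]
  exact congrArg (fun f => f p) this

/-- The action of the torus on its function field by translations. -/
noncomputable def torusTranslation {u : Fin d → ℂ} (hu : ∀ j, u j ≠ 0) :
    TorusField d →+* TorusField d :=
  IsFractionRing.map (scaleVars_injective hu)

theorem torusTranslation_var {u : Fin d → ℂ} (hu : ∀ j, u j ≠ 0) (j : Fin d) :
    torusTranslation hu (torusVar j) = torusConst d (u j) * torusVar j := by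
  rw [torusTranslation, IsFractionRing.map, torusVar, IsLocalization.map_eq]
  simp [scaleVars, torusConst]

theorem torusTranslation_const {u : Fin d → ℂ} (hu : ∀ j, u j ≠ 0) (c : ℂ) :
    torusTranslation hu (torusConst d c) = torusConst d c := by
  rw [torusTranslation, IsFractionRing.map, torusConst, RingHom.comp_apply, IsLocalization.map_eq]
  simp [scaleVars]

/-- This separates the eigenvalues at `s = 0`: the `ζ i` are linearly independent over `ℂ`. -/
theorem linear_form_injective (a b : Fin d → ℂ)
    (h : -∑ j, torusConst d (a j) * torusVar j = -∑ j, torusConst d (b j) * torusVar j) :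
    a = b := by
  have h1 : algebraMap (MvPolynomial (Fin d) ℂ) (TorusField d)
        (∑ j, MvPolynomial.C (a j) * MvPolynomial.X j) =
      algebraMap _ _ (∑ j, MvPolynomial.C (b j) * MvPolynomial.X j) := by
    simpa [torusConst, torusVar] using h
  have h2 := IsFractionRing.injective _ _ h1
  funext i
  have h3 := congrArg (MvPolynomial.coeff (Finsupp.single i 1)) h2
  simpa [MvPolynomial.coeff_sum, MvPolynomial.coeff_C_mul, MvPolynomial.coeff_X,
    Finsupp.single_left_inj] using h3

/-- The field of rational functions in `d + 1` variables; the last variable is the scaling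
parameter. -/
abbrev ScaleField (d : ℕ) : Type := FractionRing (TorusField d)[X]

/-- The extension of an endomorphism of the field of rational functions in `d` variables fixing the
scaling parameter. -/
noncomputable def extendScale (σ : TorusField d →+* TorusField d) :
    ScaleField d →+* ScaleField d :=
  IsFractionRing.map (j := mapRingHom σ) (map_injective _ σ.injective)

theorem extendScale_algebraMap (σ : TorusField d →+* TorusField d) (p : (TorusField d)[X]) :
    extendScale σ (algebraMap _ _ p) = algebraMap (TorusField d)[X] (ScaleField d) (p.map σ) := by
  exact IsLocalization.map_eq (M := nonZeroDivisors (TorusField d)[X])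
    (nonZeroDivisors_le_comap_nonZeroDivisors_of_injective _ (map_injective _ σ.injective)) p

/-- The scaling parameter. -/
noncomputable def scaleParam (d : ℕ) : ScaleField d := algebraMap (TorusField d)[X] _ X

theorem scaleParam_ne_zero : scaleParam d ≠ 0 := by
  rw [scaleParam, Ne, FaithfulSMul.algebraMap_eq_zero_iff]
  exact X_ne_zero

/-- The inclusion of the rational functions in `d` variables. -/
noncomputable def scaleIncl (d : ℕ) : TorusField d →+* ScaleField d :=
  (algebraMap (TorusField d)[X] (ScaleField d)).comp C

theorem extendScale_param (σ : TorusField d →+* TorusField d) :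
    extendScale σ (scaleParam d) = scaleParam d := by
  rw [scaleParam, extendScale_algebraMap, map_X]

theorem extendScale_incl (σ : TorusField d →+* TorusField d) (x : TorusField d) :
    extendScale σ (scaleIncl d x) = scaleIncl d (σ x) := by
  rw [scaleIncl, RingHom.comp_apply, extendScale_algebraMap, map_C]
  rfl

/-- The point `z j = (ζ j / s) ^ q j` of the torus, as a homomorphism on Laurent polynomials;
here `s` is the scaling parameter. -/
noncomputable def scaledPoint (q : Fin d → ℕ) : MvLaurent (Fin d) →+* ScaleField d :=
  AddMonoidAlgebra.liftNCRingHom ((scaleIncl d).comp (torusConst d))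
    { toFun := fun a => latticePow (fun j => (scaleParam d)⁻¹ * scaleIncl d (torusVar j))
        fun j => q j * a.toAdd j
      map_one' := by simp [latticePow]
      map_mul' := fun a b => by
        rw [← latticePow_add]
        · congr 1
          funext j
          simp [mul_add]
        · intro j
          exact mul_ne_zero (inv_ne_zero scaleParam_ne_zero)
            ((_root_.map_ne_zero _).2 (torusVar_ne_zero j)) }
    fun _ _ => Commute.all _ _

theorem scaledPoint_single (q : Fin d → ℕ) (a : Fin d → ℤ) (c : ℂ) :
    scaledPoint q (AddMonoidAlgebra.single a c) = scaleIncl d (torusConst d c) *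
      latticePow (fun j => (scaleParam d)⁻¹ * scaleIncl d (torusVar j)) fun j => q j * a j := by
  simp [scaledPoint, AddMonoidAlgebra.liftNCRingHom]

/-- The scaled point depends on `ζ j` only through `ζ j ^ q j`, which a `q j`-th root of unity
leaves unchanged. -/
theorem extendScale_scaledPoint (q : Fin d → ℕ) {u : Fin d → ℂ} (hu : ∀ j, u j ≠ 0)
    (huq : ∀ j, u j ^ q j = 1) (x : MvLaurent (Fin d)) :
    extendScale (torusTranslation hu) (scaledPoint q x) = scaledPoint q x := by
  induction x using AddMonoidAlgebra.induction_linear with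
  | zero => simp
  | add x y hx hy => rw [map_add, map_add, hx, hy]
  | single a c =>
    rw [scaledPoint_single, map_mul, extendScale_incl, torusTranslation_const]
    congr 1
    simp only [latticePow, map_prod]
    refine Finset.prod_congr rfl fun j _ => ?_
    rw [map_zpow₀, map_mul, map_inv₀, extendScale_param, extendScale_incl, torusTranslation_var,
      map_mul, zpow_mul, zpow_mul]
    congr 1
    rw [zpow_natCast, zpow_natCast, mul_left_comm, mul_pow, ← map_pow, ← map_pow, huq, map_one,
      map_one, one_mul]

/-! ### Monic factors of the characteristic polynomial -/

variable (q : Fin d → ℕ) [∀ j, NeZero (q j)] (v : Cell q → ℂ)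

/-- The matrix of `-Δ + v`, with entries Laurent polynomials in `z`. -/
noncomputable def laurentMatrix : Matrix (Cell q) (Cell q) (MvLaurent (Fin d)) :=
  blochMatrix q (fun a => AddMonoidAlgebra.single a 1) fun n => AddMonoidAlgebra.single 0 (v n)

/-- The matrix of `-Δ + v` at the scaled point, conjugated to polynomial form and multiplied by the
scaling parameter. -/
noncomputable def scaledMatrix : Matrix (Cell q) (Cell q) (TorusField d)[X] :=
  shiftMatrix q (fun j => C (torusVar j)) (fun j => X ^ 2 * C (torusVar j)⁻¹)
    fun n => X * C (torusConst d (v n))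

/-- Conjugation gives coefficients `ζ j / s` and `s / ζ j`; the extra factor `s` clears the pole, at
the cost of scaling the roots. -/
theorem charpoly_scaledMatrix :
    (scaledMatrix q v).charpoly.map (algebraMap _ (ScaleField d)) =
      ((laurentMatrix q v).charpoly.map (scaledPoint q)).scaleRoots (scaleParam d) := by
  have hs := scaleParam_ne_zero (d := d)
  have hy : ∀ j, (scaleParam d)⁻¹ * scaleIncl d (torusVar j) ≠ 0 := fun j =>
    mul_ne_zero (inv_ne_zero hs) ((_root_.map_ne_zero _).2 (torusVar_ne_zero j))
  rw [← Matrix.charpoly_map, ← Matrix.charpoly_map, laurentMatrix, blochMatrix_map]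
  simp only [scaledPoint_single, map_one, one_mul]
  rw [charpoly_blochMatrix q hy, ← Matrix.charpoly_smul_eq_scaleRoots _ hs, smul_shiftMatrix,
    scaledMatrix, shiftMatrix_map]
  congr 2
  · funext j
    rw [mul_inv_cancel_left₀ hs]
    rfl
  · funext j
    rw [mul_inv, inv_inv, map_mul, map_pow, pow_two, mul_assoc, ← map_inv₀]
    rfl
  · funext n
    rw [map_mul]
    congr 1
    simp [latticePow, scaleIncl]

/-- The potential carries a factor `s` and so disappears here, which is why `v` can be arbitrary. -/
theorem scaledMatrix_eval_zero :
    (scaledMatrix q v).map (evalRingHom 0) = shiftMatrix q torusVar 0 0 := by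
  rw [scaledMatrix, shiftMatrix_map]
  congr 1
  · funext j; simp
  · funext j; simp
  · funext j; simp

theorem laurentMatrix_charpoly_factor {f g : (MvLaurent (Fin d))[X]} (hf : f.Monic) (hg : g.Monic)
    (h : f * g = (laurentMatrix q v).charpoly) : f.natDegree = 0 ∨ g.natDegree = 0 := by
  have hs := scaleParam_ne_zero (d := d)
  -- factors at the scaled point, with polynomial coefficients in the scaling parameter
  have hprod : (f.map (scaledPoint q)).scaleRoots (scaleParam d) *
      (g.map (scaledPoint q)).scaleRoots (scaleParam d) =
        (scaledMatrix q v).charpoly.map (algebraMap _ (ScaleField d)) := by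
    rw [charpoly_scaledMatrix, ← h, Polynomial.map_mul, mul_scaleRoots_of_noZeroDivisors]
  have hf' := (monic_scaleRoots_iff (scaleParam d)).2 (hf.map (scaledPoint q))
  have hg' := (monic_scaleRoots_iff (scaleParam d)).2 (hg.map (scaledPoint q))
  have hp := Matrix.charpoly_monic (scaledMatrix q v)
  -- A priori the coefficients are only rational in `s`; integral closedness of `K[s]` excludes
  -- poles, so `s = 0` may be substituted.
  obtain ⟨F, hF⟩ := hp.exists_map_eq_of_mul_eq_map hf' hprod
  obtain ⟨G, hG⟩ := hp.exists_map_eq_of_mul_eq_map hg' ((mul_comm _ _).trans hprod)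
  have hinj := IsFractionRing.injective (TorusField d)[X] (ScaleField d)
  have hFm : F.Monic := monic_of_injective hinj (hF ▸ hf')
  have hGm : G.Monic := monic_of_injective hinj (hG ▸ hg')
  have hFd : F.natDegree = f.natDegree := by
    rw [← hFm.natDegree_map (algebraMap _ (ScaleField d)), hF, natDegree_scaleRoots,
      hf.natDegree_map]
  have hGd : G.natDegree = g.natDegree := by
    rw [← hGm.natDegree_map (algebraMap _ (ScaleField d)), hG, natDegree_scaleRoots,
      hg.natDegree_map]
  have hFG : F * G = (scaledMatrix q v).charpoly :=
    map_injective _ hinj (by rw [Polynomial.map_mul, hF, hG, hprod])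
  -- invariance under the deck group
  have hinv : ∀ (p : (MvLaurent (Fin d))[X]) (P : (TorusField d)[X][X]),
      P.map (algebraMap _ (ScaleField d)) =
        (p.map (scaledPoint q)).scaleRoots (scaleParam d) →
      ∀ (u : Fin d → ℂ) (hu : ∀ j, u j ≠ 0), (∀ j, u j ^ q j = 1) →
        (P.map (evalRingHom 0)).map (torusTranslation hu) = P.map (evalRingHom 0) := by
    intro p P hP u hu huq
    -- Scaling the roots multiplies coefficients by powers of `s`, which the translation fixes along
    -- with all values at the scaled point.
    have h1 : P.map (mapRingHom (torusTranslation hu)) = P := by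
      refine map_injective _ hinj ?_
      ext i
      have h2 := congrArg (fun p => p.coeff i) hP
      simp only [coeff_map, coeff_scaleRoots] at h2
      rw [coeff_map, coeff_map, coe_mapRingHom, ← extendScale_algebraMap, coeff_map, h2, map_mul,
        extendScale_scaledPoint q hu huq, map_pow, extendScale_param]
    -- Translation acts on the coefficients of a polynomial in `s`, hence commutes with setting `s =
    -- 0`.
    have h3 : (torusTranslation hu).comp (evalRingHom 0) =
        (evalRingHom (0 : TorusField d)).comp (mapRingHom (torusTranslation hu)) := by
      ext x <;> simp
    rw [Polynomial.map_map, h3, ← Polynomial.map_map, h1]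
  -- the roots at scaling parameter zero
  have hprim : ∀ j, IsPrimitiveRoot (Complex.exp (2 * Real.pi * Complex.I / q j)) (q j) := fun j =>
    Complex.isPrimitiveRoot_exp (q j) (NeZero.ne _)
  -- A cell point `n` serves as the tuple of exponents, so `Cell q` indexes all tuples of `q j`-th
  -- roots of unity.
  let u : Cell q → Fin d → ℂ := fun n j => Complex.exp (2 * Real.pi * Complex.I / q j) ^ (n j : ℕ)
  have hu : ∀ n j, u n j ≠ 0 := fun n j => pow_ne_zero _ (Complex.exp_ne_zero _)
  have huq : ∀ n j, u n j ^ q j = 1 := fun n j => by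
    rw [← pow_mul, mul_comm (n j : ℕ), pow_mul, (hprim j).pow_eq_one, one_pow]
  have hui : Function.Injective u := fun n m hnm => by
    funext j
    exact Fin.ext ((hprim j).pow_inj (n j).2 (m j).2 (congrFun hnm j))
  have hroot : (F.map (evalRingHom 0) * G.map (evalRingHom 0)).eval
      (-∑ j, torusVar (d := d) j) = 0 := by
    rw [← Polynomial.map_mul, hFG, ← Matrix.charpoly_map, scaledMatrix_eval_zero]
    -- The constant eigenvector, `ρ = 1`, suffices: transitivity supplies the other roots.
    simpa using eval_charpoly_shiftMatrix q (torusVar (d := d)) (ρ := 1) (by simp)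
  have hcard : f.natDegree + g.natDegree = Fintype.card (Cell q) := by
    rw [← hFd, ← hGd, ← hFm.natDegree_mul hGm, hFG, Matrix.charpoly_natDegree_eq_dim]
  have : Nonempty (Cell q) := ⟨residue q 0⟩
  have key := card_le_natDegree_of_transitive (fun n => -∑ j, torusConst d (u n j) * torusVar j)
    (fun n m h => hui (linear_form_injective _ _ h)) (fun n => torusTranslation (hu n))
    (-∑ j, torusVar j) (fun n => by simp [torusTranslation_var])
    (hFm.map (evalRingHom 0)).ne_zero (hGm.map (evalRingHom 0)).ne_zero
    (fun n => hinv f F hF (u n) (hu n) (huq n)) (fun n => hinv g G hG (u n) (hu n) (huq n))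
    hroot
  -- The degrees add up to `Q`, and one of them is at least `Q`.
  rw [hFm.natDegree_map, hGm.natDegree_map, hFd, hGd] at key
  omega

end Torus

end Floquet

/-! ### Units and monomials -/

/-- A unit of the ring of Laurent polynomials is a monomial. -/
theorem MvLaurent.IsMonomial.of_mul_eq_one {σ : Type*} [Finite σ] {f g : MvLaurent σ}
    (h : f * g = 1) : f.IsMonomial := by
  classical
  have hf : f ≠ 0 := left_ne_zero_of_mul_eq_one h
  have hg : g ≠ 0 := right_ne_zero_of_mul_eq_one h
  have hfc : 0 < f.coeff.support.card := by simpa [Finset.card_pos] using hf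
  have hgc : 0 < g.coeff.support.card := by simpa [Finset.card_pos] using hg
  have hle : f.coeff.support.card * g.coeff.support.card ≤ 1 := by
    by_contra! hlt
    -- Were the supports larger, two different pairs of exponents would have sums attained only
    -- once. Neither term cancels in `f * g = 1`, so both sums are `0`, against uniqueness.
    obtain ⟨p, hp, p', hp', hne, hu, hu'⟩ := TwoUniqueSums.uniqueAdd_of_one_lt_card hlt
    rw [Finset.mem_product] at hp hp'
    have key : ∀ r : (σ → ℤ) × (σ → ℤ), r.1 ∈ f.coeff.support → r.2 ∈ g.coeff.support →
        UniqueAdd f.coeff.support g.coeff.support r.1 r.2 → r.1 + r.2 = 0 := by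
      intro r h1 h2 hr
      by_contra hr0
      have h3 := AddMonoidAlgebra.coeff_mul_add_of_uniqueAdd hr
      rw [h, AddMonoidAlgebra.one_def, AddMonoidAlgebra.coeff_single,
        Finsupp.single_eq_of_ne hr0] at h3
      exact mul_ne_zero (Finsupp.mem_support_iff.1 h1) (Finsupp.mem_support_iff.1 h2) h3.symm
    have h0 := key p hp.1 hp.2 hu
    have h0' := key p' hp'.1 hp'.2 hu'
    obtain ⟨e1, e2⟩ := hu hp'.1 hp'.2 (h0'.trans h0.symm)
    exact hne (Prod.ext e1.symm e2.symm)
  have hone : f.coeff.support.card = 1 := by nlinarith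
  obtain ⟨a, c, hc, hac⟩ := Finsupp.card_support_eq_one'.1 hone
  exact ⟨a, c, hc, AddMonoidAlgebra.coeff_injective hac⟩

theorem MvLaurent.IsMonomial.mul {σ : Type*} {f g : MvLaurent σ} (hf : f.IsMonomial)
    (hg : g.IsMonomial) : (f * g).IsMonomial := by
  obtain ⟨a, c, hc, rfl⟩ := hf
  obtain ⟨b, e, he, rfl⟩ := hg
  exact ⟨a + b, c * e, mul_ne_zero hc he, AddMonoidAlgebra.single_mul_single ..⟩

/-! ### Passage between Laurent polynomials and polynomials in `lam` -/

namespace Floquet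

variable {d : ℕ}

/-- The inclusion of the Laurent polynomials in `z` into those in `z` and `lam`. -/
noncomputable def inclZ (d : ℕ) : MvLaurent (Fin d) →+* Ring d :=
  AddMonoidAlgebra.mapDomainRingHom ℂ
    ({ toFun := fun a => Fin.snoc (α := fun _ => ℤ) a 0
       map_zero' := by
        funext i
        refine Fin.lastCases ?_ (fun i => ?_) i <;> simp
       map_add' := fun a b => by
        funext i
        refine Fin.lastCases ?_ (fun i => ?_) i <;> simp } : (Fin d → ℤ) →+ (Fin (d + 1) → ℤ))

theorem inclZ_single (a : Fin d → ℤ) (c : ℂ) :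
    inclZ d (AddMonoidAlgebra.single a c) =
      AddMonoidAlgebra.single (Fin.snoc (α := fun _ => ℤ) a 0) c := by
  simp [inclZ]

theorem lam_pow (k : ℕ) :
    (lam : Ring d) ^ k = AddMonoidAlgebra.single (Pi.single (Fin.last d) (k : ℤ)) 1 := by
  rw [lam, AddMonoidAlgebra.single_pow, one_pow]
  congr 1
  rw [← Pi.single_smul, nsmul_eq_mul, mul_one]

theorem isUnit_lam : IsUnit (lam : Ring d) := by
  refine IsUnit.of_mul_eq_one (AddMonoidAlgebra.single (-Pi.single (Fin.last d) 1) 1) ?_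
  rw [lam, AddMonoidAlgebra.single_mul_single, add_neg_cancel, one_mul, AddMonoidAlgebra.one_def]

/-- Polynomials in `lam` with coefficients Laurent polynomials in `z`, as Laurent polynomials. -/
noncomputable def ofPoly (d : ℕ) : (MvLaurent (Fin d))[X] →+* Ring d :=
  eval₂RingHom (inclZ d) lam

theorem ofPoly_monomial_single (k : ℕ) (a : Fin d → ℤ) (c : ℂ) :
    ofPoly d (monomial k (AddMonoidAlgebra.single a c)) =
      AddMonoidAlgebra.single (Fin.snoc (α := fun _ => ℤ) a (k : ℤ)) c := by
  rw [ofPoly, coe_eval₂RingHom, eval₂_monomial, inclZ_single, lam_pow,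
    AddMonoidAlgebra.single_mul_single, mul_one]
  congr 1
  funext i
  refine Fin.lastCases ?_ (fun i => ?_) i <;> simp

/-- Reading off coefficients gives injectivity of `ofPoly`, by which factorizations are pulled back
to polynomials in `lam`. -/
theorem coeff_ofPoly (p : (MvLaurent (Fin d))[X]) (k : ℕ) (a : Fin d → ℤ) :
    (ofPoly d p).coeff (Fin.snoc (α := fun _ => ℤ) a (k : ℤ)) = (p.coeff k).coeff a := by
  classical
  induction p using Polynomial.induction_on' with
  | add p r hp hr => simp [hp, hr]
  | monomial m x =>
    induction x using AddMonoidAlgebra.induction_linear with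
    | zero => simp
    | add x y hx hy => simp [hx, hy]
    | single b c =>
      rw [ofPoly_monomial_single, coeff_monomial, AddMonoidAlgebra.coeff_single,
        Finsupp.single_apply]
      by_cases hk : m = k
      · subst hk
        simp [Fin.snoc_inj, Finsupp.single_apply]
      · rw [if_neg hk, if_neg fun h => hk (by simpa using congrFun h (Fin.last d))]
        simp

theorem ofPoly_injective : Function.Injective (ofPoly d) := by
  intro p r h
  ext k a
  rw [← coeff_ofPoly, h, coeff_ofPoly]

theorem exists_lam_pow_mul_eq_ofPoly (f : Ring d) :
    ∃ (k : ℕ) (p : (MvLaurent (Fin d))[X]), lam ^ k * f = ofPoly d p := by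
  induction f using AddMonoidAlgebra.induction_linear with
  | zero => exact ⟨0, 0, by simp⟩
  | add f g hf hg =>
    obtain ⟨k, p, hp⟩ := hf
    obtain ⟨l, r, hr⟩ := hg
    refine ⟨k + l, X ^ l * p + X ^ k * r, ?_⟩
    have hX : ofPoly d X = lam := by simp [ofPoly]
    rw [map_add, map_mul, map_mul, map_pow, map_pow, hX, ← hp, ← hr]
    ring
  | single a c =>
    -- Adding its absolute value makes the exponent of `lam` nonnegative, so `toNat` loses nothing.
    refine ⟨(a (Fin.last d)).natAbs, monomial (a (Fin.last d) + (a (Fin.last d)).natAbs).toNat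
      (AddMonoidAlgebra.single (Fin.init a) c), ?_⟩
    rw [ofPoly_monomial_single, lam_pow, AddMonoidAlgebra.single_mul_single, one_mul]
    congr 1
    funext i
    refine Fin.lastCases ?_ (fun i => ?_) i
    · simp only [Pi.add_apply, Pi.single_eq_same, Fin.snoc_last]
      omega
    · simp [Fin.init]

theorem isMonomial_ofPoly_of_natDegree_eq_zero {p : (MvLaurent (Fin d))[X]} (hp : p.natDegree = 0)
    (hu : IsUnit p.leadingCoeff) : (ofPoly d p).IsMonomial := by
  rw [leadingCoeff, hp] at hu
  obtain ⟨w, hw⟩ := isUnit_iff_exists_inv.1 hu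
  obtain ⟨a, c, hc, h⟩ := MvLaurent.IsMonomial.of_mul_eq_one hw
  rw [eq_C_of_natDegree_eq_zero hp, h, ← monomial_zero_left, ofPoly_monomial_single]
  exact ⟨_, c, hc, rfl⟩

theorem isMonomial_of_lam_pow_mul {f : Ring d} (k : ℕ) (h : (lam ^ k * f).IsMonomial) :
    f.IsMonomial := by
  obtain ⟨w, hw⟩ := isUnit_iff_exists_inv'.1 (isUnit_lam (d := d).pow k)
  have : f = w * (lam ^ k * f) := by rw [← mul_assoc, hw, one_mul]
  rw [this]
  exact (MvLaurent.IsMonomial.of_mul_eq_one hw).mul h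

theorem isMonomial_lam_pow (k : ℕ) : (lam ^ k : Ring d).IsMonomial := by
  rw [lam_pow]
  exact ⟨_, 1, one_ne_zero, rfl⟩

/-- The sign comes from `det (M - lam)` versus `det (lam - M)`. -/
theorem dispersion_eq (q : Fin d → ℕ) [∀ j, NeZero (q j)] (V : (Fin d → ℤ) → ℂ) :
    dispersion q V = (-1) ^ Fintype.card (Cell q) *
      ofPoly d (laurentMatrix q fun n => V n.toLattice).charpoly := by
  have h : floquetMatrix q V = (laurentMatrix q fun n => V n.toLattice).map (inclZ d) := by
    rw [floquetMatrix_eq_blochMatrix, laurentMatrix, blochMatrix_map]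
    congr 1
    · funext a
      rw [inclZ_single, zPow]
    · funext n
      rw [inclZ_single, const]
      congr 1
      funext i
      refine Fin.lastCases ?_ (fun i => ?_) i <;> simp
  rw [dispersion, h, ofPoly, coe_eval₂RingHom, ← eval_map, ← Matrix.charpoly_map,
    Matrix.eval_charpoly, ← Matrix.det_neg, neg_sub]

end Floquet

/-! ### Irreducibility -/

open Floquet in
theorem mainTheorem3 (d : ℕ) (hd : 2 ≤ d) (q : Fin d → ℕ) [∀ j, NeZero (q j)]
    (hgcd : Finset.univ.gcd q = 1) (V : (Fin d → ℤ) → ℂ) (hV : Floquet.IsPeriodic q V) :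
    (Floquet.dispersion q V).IsIrreducible := by
  rintro ⟨f, g, hf, hg, hfg⟩
  rw [dispersion_eq] at hfg
  set p := (laurentMatrix q fun n => V n.toLattice).charpoly with hp
  obtain ⟨k, F, hF⟩ := exists_lam_pow_mul_eq_ofPoly f
  obtain ⟨l, G, hG⟩ := exists_lam_pow_mul_eq_ofPoly g
  -- clear denominators, then remove the powers of the spectral variable
  have hFG : F * G = ((-1) ^ Fintype.card (Cell q) * p) * X ^ (k + l) := by
    apply ofPoly_injective
    have hX : ofPoly d X = lam := by simp [ofPoly]
    rw [map_mul, ← hF, ← hG, map_mul, map_mul, map_pow, map_pow, map_neg, map_one, hX, hfg]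
    ring
  -- `X` is prime, so the factor `X ^ (k + l)` splits between `F` and `G`, leaving a factorization
  -- of `±p`.
  obtain ⟨i, j, F', G', -, hprod, rfl, rfl⟩ := mul_eq_mul_prime_pow prime_X hFG
  have hsq : ((-1 : MvLaurent (Fin d)) ^ Fintype.card (Cell q)) *
      (-1) ^ Fintype.card (Cell q) = 1 := by
    rw [← mul_pow]; simp
  -- Since `p` is monic, the leading coefficients multiply to `±1`; being units, they can be
  -- normalized away.
  have hlc : F'.leadingCoeff * G'.leadingCoeff = (-1) ^ Fintype.card (Cell q) := by
    have h1 : (-1 : (MvLaurent (Fin d))[X]) ^ Fintype.card (Cell q) =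
        C ((-1) ^ Fintype.card (Cell q)) := by simp
    rw [← leadingCoeff_mul, ← hprod, h1, leadingCoeff_mul, leadingCoeff_C, hp,
      (Matrix.charpoly_monic _).leadingCoeff, mul_one]
  have hunit : IsUnit (F'.leadingCoeff * G'.leadingCoeff) := by
    rw [hlc]; exact IsUnit.of_mul_eq_one _ hsq
  have hFu : IsUnit F'.leadingCoeff := isUnit_of_mul_isUnit_left hunit
  have hGu : IsUnit G'.leadingCoeff := isUnit_of_mul_isUnit_right hunit
  -- normalize the factors to be monic
  obtain ⟨a, ha⟩ := isUnit_iff_exists_inv'.1 hFu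
  obtain ⟨b, hb⟩ := isUnit_iff_exists_inv'.1 hGu
  have ha0 := left_ne_zero_of_mul_eq_one ha
  have hb0 := left_ne_zero_of_mul_eq_one hb
  have hFm : (C a * F').Monic := by rw [Monic, leadingCoeff_mul, leadingCoeff_C, ha]
  have hGm : (C b * G').Monic := by rw [Monic, leadingCoeff_mul, leadingCoeff_C, hb]
  have hab : a * b * (-1) ^ Fintype.card (Cell q) = 1 := by
    rw [← hlc, mul_mul_mul_comm, ha, hb, one_mul]
  have hmul : C a * F' * (C b * G') = p := by
    rw [mul_mul_mul_comm, ← hprod, ← mul_assoc, ← C_mul]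
    have h1 : C (a * b) * (-1) ^ Fintype.card (Cell q) = 1 := by
      simpa using congrArg C hab
    rw [h1, one_mul]
  have hX : ofPoly d X = lam := by simp [ofPoly]
  rcases laurentMatrix_charpoly_factor q _ hFm hGm hmul with h | h
  · rw [natDegree_C_mul ha0] at h
    refine hf (isMonomial_of_lam_pow_mul k ?_)
    rw [hF, map_mul, map_pow, hX]
    exact (isMonomial_ofPoly_of_natDegree_eq_zero h hFu).mul (isMonomial_lam_pow i)
  · rw [natDegree_C_mul hb0] at h
    refine hg (isMonomial_of_lam_pow_mul l ?_)
    rw [hG, map_mul, map_pow, hX]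
    exact (isMonomial_ofPoly_of_natDegree_eq_zero h hGu).mul (isMonomial_lam_pow j)
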